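/- **Notation.** In a group write $[a,b]=a^{-1}b^{-1}ab$ and $t^g=g^{-1}tg$. For a group $G$ let $\gamma_1(G)=G$, $\gamma_{j+1}(G)=[\gamma_j(G),G]$, $G'=\gamma_2(G)$. If $G$ is a finite 3-group of nilpotency class $m-1$, then $m$ is its *nilpotency index*. Its *CF-invariant* $e$ is defined by $e+1=\min\{j\ge 3 : (\gamma_j(G):\gamma_{j+1}(G))\le 3\}$. Let $\chi_j(G)=\{g\in G : [u,g]\in\gamma_{j+2}(G)\text{ for all }u\in\gamma_j(G)\}$ and $s=\min\{2\le j\le m-1 : \chi_j(G)>G'\}$. The *defect of commutativity* $k\in\{0,1\}$ of $G$ is defined by $[\chi_s(G),\gamma_e(G)]=\gamma_{m-k}(G)$. *Annihilator.* Let $G$ be metabelian (that is, $G'$ is abelian) and $x,y\in G$. The right action of $G$ on $G'$ by $t\mapsto t^g$ extends to $\mathbb Z[G]$. Put $s_2=[y,x]$. The annihilator of $G$ with respect to $x,y$ is the ideal $$\mathfrak A=\{f\in\mathbb Z[X,Y] : s_2^{f(x-1,y-1)}=1\},$$ where $X^iY^j$ is evaluated as $(x-1)^i(y-1)^j$. *Nebelung's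 representative.* For elements $x,y$ put $s_2=t_2=[y,x]$, $s_j=[s_{j-1},x]$, $t_j=[t_{j-1},y]$ ($j\ge 3$), $\sigma_3=y^3$, $\tau_3=x^3$, $\sigma_j=[\sigma_{j-1},x]$, $\tau_j=[\tau_{j-1},y]$ ($j\ge4$). Given $m\ge 4$, $m+1\le n\le 2m-3$, $e=n-m+2$, $k\in\{0,1\}$ and integers $-1\le\alpha,\beta,\gamma,\delta,\rho\le1$, the representative $G_\rho^{m,n}(\alpha,\beta,\gamma,\delta)$ of defect $k$ is the group generated by $x,y$ with the following defining relations: 1. the commutator subgroup is abelian; 2. $s_i^3s_{i+1}^3s_{i+2}=t_i^3t_{i+1}^3t_{i+2}=\sigma_i^3\sigma_{i+1}^3\sigma_{i+2}=\tau_i^3\tau_{i+1}^3\tau_{i+2}=1$ for $i\ge3$; $s_2^3s_3^3s_4=\tau_4^{-1}$; $t_2^3t_3^3t_4=\sigma_4$; 3. $[\sigma_j,y]=[\tau_j,x]=1$ for $j\ge3$; 4. $\sigma_i=1$ for $i\ge m$; $\tau_j=1$ for $j\ge e+k+1$; 5. $\sigma_i=s_{i-2}^3$, $\tau_i=t_{i-2}^{-3}$,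 $s_i=\sigma_i^{-1}\sigma_{i+1}^{-1}$, $t_i=\tau_i\tau_{i+1}$ for $i\ge5$; 6. $[s_3,y]=[s_3\sigma_3\sigma_4,y]=[t_3,x]=[t_3\tau_3^{-1}\tau_4^{-1},x]=\sigma_{m-1}^{-\rho\delta}$; 7. $s_2^3(s_3t_3)^3s_4t_4=[s_3\sigma_3\sigma_4,x]=[t_3\tau_3^{-1}\tau_4^{-1},y]=\sigma_{m-1}^{\rho\beta}$; $\tau_{e+1}=\sigma_{m-1}^{-\rho}$; 8. $s_4\sigma_4\sigma_5=t_4\tau_4^{-1}\tau_5^{-1}=s_2^{-3}\sigma_4\tau_4^{-1}=\sigma_{m-1}^{\rho\beta}$; $s_3\sigma_3\sigma_4=\sigma_{m-2}^{\rho\beta}\sigma_{m-1}^{\gamma}\tau_e^{\delta}$; $t_3^{-1}\tau_3\tau_4=\sigma_{m-2}^{\rho\delta}\sigma_{m-1}^{\alpha}\tau_e^{\beta}$. (For $m=4$, where $\rho\beta$ or $\rho\delta$ is nonzero, read $\sigma_{2}$ as $\sigma_3$; in the groups that actually occur one has $k=0\iff\rho=0$, and $\rho=0$ for $m=4$.)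 **Theorem.** Let $G$ be a finite metabelian 3-group with $G/G'$ of type $(3,3)$, of order $3^n\ge3^5$, nilpotency index $m\ge4$ with $m+1\le n\le 2m-3$, CF-invariant $e=n-m+2$ (so $3\le e\le m-1$, and $G$ has coclass $e-1\ge 2$), and defect of commutativity $k\in\{0,1\}$. Assume that $G$ is isomorphic to the representative $G_\rho^{m,n}(\alpha,\beta,\gamma,\delta)$ of defect $k$, with $-1\le\alpha,\beta,\gamma,\delta,\rho\le1$, and let $x,y\in G$ correspond to the generators of the representative. Let $T=X^2+3X+3+3Y+Y^2$. Then the annihilator $\mathfrak A\trianglelefteq\mathbb Z[X,Y]$ of $G$ with respect to $x,y$ is given as follows. 1. If $k=0$, then $\mathfrak A=(X^{m-2},\;Y^{e-1},\;XY,\;T)$. 2. If $k=1$, $m\ge6$ and $e\ge4$, then $\mathfrak A=(X^{m-2},\;Y^{e-1}-\rho X^{m-3},\;XY-\rho\delta X^{m-3},\;T+\rho\beta X^{m-3})$. 3. If $k=1$, $m\ge6$ and $e=3$, then $\mathfrak A=(X^{m-2},\;Y^{2}-(1-\beta)\rho X^{m-3},\;XY-\rho\delta X^{m-3},\;T+\rho\beta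 X^{m-3})$. -/

import Mathlib

/-! ### Lower central series, CF-invariant, two-step centralizers, defect of commutativity -/

/-- The lower central series with the group-theoretic indexing `γ₁(G) = G`,
`γ_{j+1}(G) = [γ_j(G), G]` (Mathlib starts to count at `0`). -/
def gammaSeries (G : Type*) [Group G] (j : ℕ) : Subgroup G :=
  (⊤ : Subgroup G).lowerCentralSeries (j - 1)

/-- The index of nilpotency `m`, that is, `m - 1` is the nilpotency class. -/
noncomputable def nilpotencyIndex (G : Type*) [Group G] : ℕ :=
  Group.nilpotencyClass G + 1

/-- The CF-invariant `e` of a finite `3`-group `G`: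
`e + 1 = min {j ≥ 3 | (γ_j(G) : γ_{j+1}(G)) ≤ 3}`. -/
noncomputable def cfInvariant (G : Type*) [Group G] : ℕ :=
  sInf {j : ℕ | 3 ≤ j ∧ (gammaSeries G (j + 1)).relIndex (gammaSeries G j) ≤ 3} - 1

instance gammaSeries_normal (G : Type*) [Group G] (j : ℕ) : (gammaSeries G j).Normal := by
  unfold gammaSeries
  infer_instance

/-- The two-step centralizer `χ_j(G)`: the preimage in `G` of the centralizer of
`γ_j(G)/γ_{j+2}(G)` in `G/γ_{j+2}(G)`. -/
def twoStepCentralizer (G : Type*) [Group G] (j : ℕ) : Subgroup G :=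
  (Subgroup.centralizer
    (((gammaSeries G j).map (QuotientGroup.mk' (gammaSeries G (j + 2))) :
      Subgroup (G ⧸ gammaSeries G (j + 2))) : Set (G ⧸ gammaSeries G (j + 2)))).comap
    (QuotientGroup.mk' (gammaSeries G (j + 2)))

/-- The centralizer invariant `s = min {2 ≤ j ≤ m - 1 | χ_j(G) > G'}`. -/
noncomputable def centralizerInvariant (G : Type*) [Group G] : ℕ :=
  sInf {j : ℕ | 2 ≤ j ∧ j ≤ nilpotencyIndex G - 1 ∧ commutator G < twoStepCentralizer G j}

/-- `G` has defect of commutativity `k`: `0 ≤ k ≤ 1` and `[χ_s(G), γ_e(G)] = γ_{m-k}(G)`. -/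
def HasDefect (G : Type*) [Group G] (k : ℕ) : Prop :=
  k ≤ 1 ∧
    ⁅twoStepCentralizer G (centralizerInvariant G), gammaSeries G (cfInvariant G)⁆ =
      gammaSeries G (nilpotencyIndex G - k)

/-! ### Iterated commutators and Nebelung's presentation -/

section Words

variable {G : Type*} [Group G]

/-- The commutator `[a, b] = a⁻¹ b⁻¹ a b`. -/
def rightComm (a b : G) : G := a⁻¹ * b⁻¹ * a * b

/-- The iterated commutator `[a, b, …, b]` with `i` entries `b`. -/
def iterComm (a b : G) : ℕ → G
  | 0 => a
  | i + 1 => rightComm (iterComm a b i) b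

/-- `s₂ = [y, x]`, `s_j = [s_{j-1}, x]` (used for `j ≥ 2`). -/
def sElt (x y : G) (j : ℕ) : G := iterComm (rightComm y x) x (j - 2)

/-- `t₂ = [y, x]`, `t_j = [t_{j-1}, y]` (used for `j ≥ 2`). -/
def tElt (x y : G) (j : ℕ) : G := iterComm (rightComm y x) y (j - 2)

/-- `σ₃ = y³`, `σ_j = [σ_{j-1}, x]` (used for `j ≥ 3`). -/
def sigmaElt (x y : G) (j : ℕ) : G := iterComm (y ^ 3) x (j - 3)

/-- `τ₃ = x³`, `τ_j = [τ_{j-1}, y]` (used for `j ≥ 3`). -/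
def tauElt (x y : G) (j : ℕ) : G := iterComm (x ^ 3) y (j - 3)

/-- The defining relations `lhs = rhs` of Nebelung's representative, written for two elements
`x`, `y` of an arbitrary group. Here `m` is the index of nilpotency, `e` the CF-invariant and `k`
the defect of commutativity. The subscript `m - 2` occurs in `σ_{m-2}` with exponents that are
multiples of `ρ` only (for `m = 4` the parameter `ρ` vanishes). -/
inductive NebelungRel (m e k : ℕ) (ρ α β γ δ : ℤ) (x y : G) : G → G → Prop
  /-- the commutator subgroup is abelian -/
  | metabelian (a b : G) (ha : a ∈ commutator G) (hb : b ∈ commutator G) :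
      NebelungRel m e k ρ α β γ δ x y (a * b) (b * a)
  -- basic power relations
  | power_s (i : ℕ) (hi : 3 ≤ i) : NebelungRel m e k ρ α β γ δ x y
      (sElt x y i ^ 3 * sElt x y (i + 1) ^ 3 * sElt x y (i + 2)) 1
  | power_t (i : ℕ) (hi : 3 ≤ i) : NebelungRel m e k ρ α β γ δ x y
      (tElt x y i ^ 3 * tElt x y (i + 1) ^ 3 * tElt x y (i + 2)) 1
  | power_sigma (j : ℕ) (hj : 3 ≤ j) : NebelungRel m e k ρ α β γ δ x y
      (sigmaElt x y j ^ 3 * sigmaElt x y (j + 1) ^ 3 * sigmaElt x y (j + 2)) 1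
  | power_tau (j : ℕ) (hj : 3 ≤ j) : NebelungRel m e k ρ α β γ δ x y
      (tauElt x y j ^ 3 * tauElt x y (j + 1) ^ 3 * tauElt x y (j + 2)) 1
  -- supplementary power relations
  | suppl_s : NebelungRel m e k ρ α β γ δ x y
      (sElt x y 2 ^ 3 * sElt x y 3 ^ 3 * sElt x y 4) (tauElt x y 4)⁻¹
  | suppl_t : NebelungRel m e k ρ α β γ δ x y
      (tElt x y 2 ^ 3 * tElt x y 3 ^ 3 * tElt x y 4) (sigmaElt x y 4)
  -- commutator relations
  | comm_sigma (j : ℕ) (hj : 3 ≤ j) : NebelungRel m e k ρ α β γ δ x y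
      (rightComm (sigmaElt x y j) y) 1
  | comm_tau (j : ℕ) (hj : 3 ≤ j) : NebelungRel m e k ρ α β γ δ x y
      (rightComm (tauElt x y j) x) 1
  -- nilpotency relations
  | nilp_sigma (i : ℕ) (hi : m ≤ i) : NebelungRel m e k ρ α β γ δ x y (sigmaElt x y i) 1
  | nilp_tau (j : ℕ) (hj : e + k + 1 ≤ j) : NebelungRel m e k ρ α β γ δ x y (tauElt x y j) 1
  -- basic connecting relations
  | conn_sigma (i : ℕ) (hi : 5 ≤ i) : NebelungRel m e k ρ α β γ δ x y
      (sigmaElt x y i) (sElt x y (i - 2) ^ 3)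
  | conn_tau (i : ℕ) (hi : 5 ≤ i) : NebelungRel m e k ρ α β γ δ x y
      (tauElt x y i) (tElt x y (i - 2) ^ 3)⁻¹
  | conn_s (j : ℕ) (hj : 5 ≤ j) : NebelungRel m e k ρ α β γ δ x y
      (sElt x y j) ((sigmaElt x y j)⁻¹ * (sigmaElt x y (j + 1))⁻¹)
  | conn_t (j : ℕ) (hj : 5 ≤ j) : NebelungRel m e k ρ α β γ δ x y
      (tElt x y j) (tauElt x y j * tauElt x y (j + 1))
  -- first central relations, with value `σ_{m-1}^{-ρδ}`
  | central_s3_y : NebelungRel m e k ρ α β γ δ x y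
      (rightComm (sElt x y 3) y) (sigmaElt x y (m - 1) ^ (-(ρ * δ)))
  | central_s3_y' : NebelungRel m e k ρ α β γ δ x y
      (rightComm (sElt x y 3 * sigmaElt x y 3 * sigmaElt x y 4) y)
      (sigmaElt x y (m - 1) ^ (-(ρ * δ)))
  | central_t3_x : NebelungRel m e k ρ α β γ δ x y
      (rightComm (tElt x y 3) x) (sigmaElt x y (m - 1) ^ (-(ρ * δ)))
  | central_t3_x' : NebelungRel m e k ρ α β γ δ x y
      (rightComm (tElt x y 3 * (tauElt x y 3)⁻¹ * (tauElt x y 4)⁻¹) x)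
      (sigmaElt x y (m - 1) ^ (-(ρ * δ)))
  -- first central relations, with value `σ_{m-1}^{ρβ}`
  | central_trace : NebelungRel m e k ρ α β γ δ x y
      (sElt x y 2 ^ 3 * (sElt x y 3 * tElt x y 3) ^ 3 * sElt x y 4 * tElt x y 4)
      (sigmaElt x y (m - 1) ^ (ρ * β))
  | central_s3_x : NebelungRel m e k ρ α β γ δ x y
      (rightComm (sElt x y 3 * sigmaElt x y 3 * sigmaElt x y 4) x)
      (sigmaElt x y (m - 1) ^ (ρ * β))
  | central_t3_y : NebelungRel m e k ρ α β γ δ x y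
      (rightComm (tElt x y 3 * (tauElt x y 3)⁻¹ * (tauElt x y 4)⁻¹) y)
      (sigmaElt x y (m - 1) ^ (ρ * β))
  | central_tau : NebelungRel m e k ρ α β γ δ x y
      (tauElt x y (e + 1)) (sigmaElt x y (m - 1) ^ (-ρ))
  -- second central relations
  | second_s4 : NebelungRel m e k ρ α β γ δ x y
      (sElt x y 4 * sigmaElt x y 4 * sigmaElt x y 5) (sigmaElt x y (m - 1) ^ (ρ * β))
  | second_t4 : NebelungRel m e k ρ α β γ δ x y
      (tElt x y 4 * (tauElt x y 4)⁻¹ * (tauElt x y 5)⁻¹) (sigmaElt x y (m - 1) ^ (ρ * β))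
  | second_s2 : NebelungRel m e k ρ α β γ δ x y
      ((sElt x y 2 ^ 3)⁻¹ * sigmaElt x y 4 * (tauElt x y 4)⁻¹) (sigmaElt x y (m - 1) ^ (ρ * β))
  | second_s3 : NebelungRel m e k ρ α β γ δ x y
      (sElt x y 3 * sigmaElt x y 3 * sigmaElt x y 4)
      (sigmaElt x y (m - 2) ^ (ρ * β) * sigmaElt x y (m - 1) ^ γ * tauElt x y e ^ δ)
  | second_t3 : NebelungRel m e k ρ α β γ δ x y
      ((tElt x y 3)⁻¹ * tauElt x y 3 * tauElt x y 4)
      (sigmaElt x y (m - 2) ^ (ρ * δ) * sigmaElt x y (m - 1) ^ α * tauElt x y e ^ β)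

end Words

/-- The relators of Nebelung's representative in the free group on `x = of 0`, `y = of 1`;
the CF-invariant is `e = n - m + 2`. -/
def nebelungRelators (m n k : ℕ) (ρ α β γ δ : ℤ) : Set (FreeGroup (Fin 2)) :=
  {w | ∃ a b : FreeGroup (Fin 2),
    NebelungRel m (n - m + 2) k ρ α β γ δ (FreeGroup.of 0) (FreeGroup.of 1) a b ∧ w = a * b⁻¹}

/-- Nebelung's representative `G_ρ^{m,n}(α, β, γ, δ)` (with defect of commutativity `k`). -/
abbrev NebelungGroup (m n k : ℕ) (ρ α β γ δ : ℤ) : Type :=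
  PresentedGroup (nebelungRelators m n k ρ α β γ δ)

/-- The generators of Nebelung's representative: index `0` is `x`, index `1` is `y`. -/
def NebelungGroup.gen (m n k : ℕ) (ρ α β γ δ : ℤ) (i : Fin 2) : NebelungGroup m n k ρ α β γ δ :=
  PresentedGroup.of i

/-! ### Symbolic powers and the annihilator -/

section Annihilator

open scoped IsMulCommutative
open MvPolynomial

variable {G : Type*} [Group G]

section Action

variable [IsMulCommutative (commutator G)]

/-- The right action `t ↦ t^g = g⁻¹ t g` of `G` on `G'`, as a homomorphism into the opposite of the
endomorphism ring of the abelian group `G'` (written additively). -/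
def conjAction : G →* (AddMonoid.End (Additive (commutator G)))ᵐᵒᵖ where
  toFun g := MulOpposite.op
    (MonoidHom.toAdditive ((MulAut.conjNormal g⁻¹ : MulAut (commutator G)).toMonoidHom))
  map_one' := by
    apply MulOpposite.unop_injective
    refine AddMonoidHom.ext fun t => Additive.toMul.injective (Subtype.ext ?_)
    change ((MulAut.conjNormal (1 : G)⁻¹ t.toMul : commutator G) : G) = t.toMul
    simp
  map_mul' g h := by
    apply MulOpposite.unop_injective
    refine AddMonoidHom.ext fun t => Additive.toMul.injective (Subtype.ext ?_)
    change ((MulAut.conjNormal (g * h)⁻¹ t.toMul : commutator G) : G) =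
      (MulAut.conjNormal h⁻¹ (MulAut.conjNormal g⁻¹ t.toMul : commutator G) : commutator G)
    simp only [MulAut.conjNormal_apply]
    group

theorem conjAction_apply (g : G) (t : commutator G) :
    ((((conjAction g).unop (Additive.ofMul t)).toMul : commutator G) : G) = g⁻¹ * t * g := by
  change ((MulAut.conjNormal g⁻¹ t : commutator G) : G) = g⁻¹ * t * g
  simp

/-- The extension of the action of `G` on `G'` to the integral group ring `ℤ[G]`. -/
noncomputable def groupRingAction :
    MonoidAlgebra ℤ G →ₐ[ℤ] (AddMonoid.End (Additive (commutator G)))ᵐᵒᵖ :=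
  MonoidAlgebra.lift ℤ _ G conjAction

/-- The symbolic power `t^r` of `t ∈ G'` with exponent `r ∈ ℤ[G]`. -/
noncomputable def symbolicPower (t : commutator G) (r : MonoidAlgebra ℤ G) : commutator G :=
  (((groupRingAction r).unop (Additive.ofMul t)).toMul)

end Action

/-- The additive map `ψ : ℤ[X, Y] → ℤ[G]`, `f(X, Y) ↦ f(x - 1, y - 1)`, which sends the monomial
`X^i Y^j` to `(x - 1)^i (y - 1)^j`; here `X = X 0` and `Y = X 1`. -/
noncomputable def shiftedEval (x y : G) : MvPolynomial (Fin 2) ℤ →ₗ[ℤ] MonoidAlgebra ℤ G :=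
  (MvPolynomial.basisMonomials (Fin 2) ℤ).constr ℤ fun d =>
    (MonoidAlgebra.of ℤ G x - 1) ^ d 0 * (MonoidAlgebra.of ℤ G y - 1) ^ d 1

/-- The main commutator `s₂ = [y, x]` as an element of `G'`. -/
def mainCommutator (x y : G) : commutator G :=
  ⟨rightComm y x, by
    have h : y⁻¹ * x⁻¹ * y⁻¹⁻¹ * x⁻¹⁻¹ ∈ commutator G :=
      Subgroup.commutator_mem_commutator (Subgroup.mem_top _) (Subgroup.mem_top _)
    simpa [rightComm] using h⟩

variable [IsMulCommutative (commutator G)]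

/-- The map `Ψ : ℤ[X, Y] → G'`, `f ↦ s₂^{f(x-1, y-1)}`. -/
noncomputable def furtwaenglerMap (x y : G) (f : MvPolynomial (Fin 2) ℤ) : commutator G :=
  symbolicPower (mainCommutator x y) (shiftedEval x y f)

theorem conjAction_commute (x y : G) : Commute (conjAction x) (conjAction y) := by
  rw [commute_iff_eq, ← map_mul, ← map_mul]
  apply MulOpposite.unop_injective
  refine AddMonoidHom.ext fun t => ?_
  have h : (x * y) * (y * x)⁻¹ ∈ commutator G := by
    have h := Subgroup.commutator_mem_commutator (Subgroup.mem_top x) (Subgroup.mem_top y)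
    simpa [commutator_def, commutatorElement_def, mul_assoc] using h
  have hc : (x * y) * (y * x)⁻¹ * (t.toMul : G) = (t.toMul : G) * ((x * y) * (y * x)⁻¹) :=
    congrArg Subtype.val (mul_comm' (⟨_, h⟩ : commutator G) t.toMul)
  have h2 : (x * y)⁻¹ * (t.toMul : G) * (x * y) = (y * x)⁻¹ * (t.toMul : G) * (y * x) := by
    have h3 : (t.toMul : G) = ((x * y) * (y * x)⁻¹)⁻¹ * ((t.toMul : G) * ((x * y) * (y * x)⁻¹)) := by
      rw [← hc]; group
    calc (x * y)⁻¹ * (t.toMul : G) * (x * y)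
        = (x * y)⁻¹ * ((t.toMul : G) * ((x * y) * (y * x)⁻¹)) * (y * x) := by group
      _ = (y * x)⁻¹ * (t.toMul : G) * (y * x) := by rw [← hc]; group
  apply Additive.toMul.injective
  apply Subtype.ext
  exact (conjAction_apply (x * y) t.toMul).trans
    (h2.trans (conjAction_apply (y * x) t.toMul).symm)

theorem groupRingAction_shiftedEval_mul (x y : G) (f g : MvPolynomial (Fin 2) ℤ) :
    groupRingAction (shiftedEval x y (f * g)) =
      groupRingAction (shiftedEval x y f) * groupRingAction (shiftedEval x y g) := by
  have key : ∀ d : Fin 2 →₀ ℕ, ∀ c : ℤ, groupRingAction (shiftedEval x y (monomial d c)) =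
      c • ((conjAction x - 1) ^ d 0 * (conjAction y - 1) ^ d 1) := by
    intro d c
    have h1 : monomial d c = c • (basisMonomials (Fin 2) ℤ d) := by
      simp [smul_monomial]
    rw [h1, map_smul, map_smul, shiftedEval, Module.Basis.constr_basis]
    simp [groupRingAction]
  have hcomm : Commute (conjAction x - 1) (conjAction y - 1) :=
    ((conjAction_commute x y).sub_left (Commute.one_left _)).sub_right
      (((Commute.one_right _)).sub_left (Commute.one_right _))
  induction f using MvPolynomial.induction_on' with
  | add p q hp hq => rw [add_mul, map_add, map_add, hp, hq, map_add, map_add, add_mul]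
  | monomial d c =>
    induction g using MvPolynomial.induction_on' with
    | add p q hp hq => rw [mul_add, map_add, map_add, hp, hq, map_add, map_add, mul_add]
    | monomial d' c' =>
      rw [monomial_mul, key, key, key, smul_mul_smul_comm]
      congr 1
      rw [Finsupp.add_apply, Finsupp.add_apply, pow_add, pow_add,
        ((hcomm.pow_pow (d' 0) (d 1))).mul_mul_mul_comm]

/-- The annihilator `𝔄 = {f ∈ ℤ[X, Y] | s₂^{f(x-1, y-1)} = 1}` with respect to `x`, `y ∈ G`. -/
noncomputable def annihilatorIdeal (x y : G) : Ideal (MvPolynomial (Fin 2) ℤ) where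
  carrier := {f | furtwaenglerMap x y f = 1}
  zero_mem' := by
    change furtwaenglerMap x y 0 = 1
    simp [furtwaenglerMap, symbolicPower]
  add_mem' {f g} hf hg := by
    change furtwaenglerMap x y f = 1 at hf
    change furtwaenglerMap x y g = 1 at hg
    change furtwaenglerMap x y (f + g) = 1
    rw [furtwaenglerMap, symbolicPower] at hf hg ⊢
    rw [map_add, map_add, MulOpposite.unop_add]
    exact (congrArg₂ (· * ·) hf hg).trans (mul_one 1)
  smul_mem' c f hf := by
    change furtwaenglerMap x y f = 1 at hf
    change furtwaenglerMap x y (c * f) = 1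
    rw [furtwaenglerMap, symbolicPower, toMul_eq_one] at hf ⊢
    rw [mul_comm, groupRingAction_shiftedEval_mul, MulOpposite.unop_mul, AddMonoid.End.coe_mul,
      Function.comp_apply, hf, map_zero]

end Annihilator

/-- The trace polynomial `T = X² + 3X + 3 + 3Y + Y²`. -/
noncomputable def tracePoly : MvPolynomial (Fin 2) ℤ :=
  MvPolynomial.X 0 ^ 2 + 3 * MvPolynomial.X 0 + 3 + 3 * MvPolynomial.X 1 + MvPolynomial.X 1 ^ 2

/-!
The map `Ψ : f ↦ s₂^{f(x-1, y-1)}` is additive with kernel `𝔄`, and it is onto `G'` because the main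
commutator generates `G'` as a module, so the index of `𝔄` in `ℤ[X, Y]` is `|G'| = 3^{n-2}`.
Nebelung's relations put the generators of the claimed ideal `B` into `𝔄`. In `R = ℤ[X, Y]/B` the
chain `0 = (X^{m-2}) ⊆ … ⊆ (X) = (X, Y^{e-1}) ⊆ … ⊆ (X, Y) ⊆ R` has cyclic factors killed by
`(X, Y)`, because `XY` is a multiple of `X²`; and `R/(X, Y)` is a quotient of `ℤ/3`, because the
trace polynomial has constant term `3`. Hence `|R|` divides `3^{(m-3)+(e-1)} = |G'|`, which forces
`B = 𝔄`.
-/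

section Counting

variable {R : Type*} [CommRing R]

theorem card_quotient_dvd_mul_card_quotient_sup_span_singleton {M : Type*} [AddCommGroup M]
    [Module R M] {N : Submodule R M} {I : Ideal R} {g : M} (h : ∀ r ∈ I, r • g ∈ N) :
    Nat.card (M ⧸ N) ∣ Nat.card (R ⧸ I) * Nat.card (M ⧸ N ⊔ R ∙ g) := by
  have hrel : N.toAddSubgroup.relIndex (R ∙ g).toAddSubgroup ∣ I.toAddSubgroup.index := by
    have hcomap := N.toAddSubgroup.index_comap (LinearMap.toSpanSingleton R M g).toAddMonoidHom
    rw [show (LinearMap.toSpanSingleton R M g).toAddMonoidHom.range = (R ∙ g).toAddSubgroup by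
      ext; simp [Submodule.mem_span_singleton]] at hcomap
    rw [← hcomap]
    exact AddSubgroup.index_dvd_of_le h
  change N.toAddSubgroup.index ∣ I.toAddSubgroup.index * (N ⊔ R ∙ g).toAddSubgroup.index
  rw [← AddSubgroup.relIndex_mul_index (Submodule.toAddSubgroup_mono le_sup_left),
    Submodule.sup_toAddSubgroup, AddSubgroup.relIndex_sup_left]
  exact mul_dvd_mul_right hrel _

theorem card_quotient_span_singleton_pow_dvd {x y : R} (hxy : x ^ 2 ∣ x * y) (d : ℕ) :
    Nat.card (R ⧸ Ideal.span {x ^ (d + 1)}) ∣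
      Nat.card (R ⧸ Ideal.span {x, y}) ^ d * Nat.card (R ⧸ Ideal.span {x}) := by
  induction d with
  | zero => simp
  | succ d ih =>
    have hann : ∀ r ∈ Ideal.span {x, y}, r • x ^ (d + 1) ∈ Ideal.span {x ^ (d + 2)} := by
      intro r hr
      obtain ⟨a, b, rfl⟩ := Ideal.mem_span_pair.1 hr
      obtain ⟨c, hc⟩ := hxy
      refine Ideal.mem_span_singleton'.2 ⟨a + b * c, ?_⟩
      rw [smul_eq_mul]
      linear_combination (-b * x ^ d) * hc
    have hle : Ideal.span {x ^ (d + 2)} ≤ Ideal.span {x ^ (d + 1)} :=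
      Ideal.span_singleton_le_span_singleton.2 (pow_dvd_pow x (d + 1).le_succ)
    have hstep := card_quotient_dvd_mul_card_quotient_sup_span_singleton hann
    rw [sup_eq_right.2 hle] at hstep
    rw [pow_succ' (Nat.card _), mul_assoc]
    exact hstep.trans (mul_dvd_mul_left _ ih)

theorem card_quotient_span_pair_pow_dvd (x y : R) (v : ℕ) :
    Nat.card (R ⧸ Ideal.span {x, y ^ v}) ∣ Nat.card (R ⧸ Ideal.span {x, y}) ^ v := by
  induction v with
  | zero =>
    rw [pow_zero, pow_zero, Ideal.eq_top_of_isUnit_mem (Ideal.span {x, 1}) (x := 1)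
      (Ideal.subset_span (by simp)) isUnit_one]
    exact dvd_of_eq Nat.card_unique
  | succ v ih =>
    have hann : ∀ r ∈ Ideal.span {x, y}, r • y ^ v ∈ Ideal.span {x, y ^ (v + 1)} := by
      intro r hr
      obtain ⟨a, b, rfl⟩ := Ideal.mem_span_pair.1 hr
      refine Ideal.mem_span_pair.2 ⟨a * y ^ v, b, ?_⟩
      rw [smul_eq_mul]
      ring
    have hsup : Ideal.span {x, y ^ (v + 1)} ⊔ Ideal.span {y ^ v} = Ideal.span {x, y ^ v} := by
      rw [Ideal.span_insert, Ideal.span_insert, sup_assoc, sup_eq_right.2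
        (Ideal.span_singleton_le_span_singleton.2 (pow_dvd_pow y v.le_succ))]
    have hstep := card_quotient_dvd_mul_card_quotient_sup_span_singleton hann
    rw [hsup] at hstep
    rw [pow_succ' (Nat.card _)]
    exact hstep.trans (mul_dvd_mul_left _ ih)

theorem card_dvd_card_quotient_span_pair_pow {x y : R} {d v : ℕ} (hx : x ^ (d + 1) = 0)
    (hy : x ∣ y ^ v) (hxy : x ^ 2 ∣ x * y) :
    Nat.card R ∣ Nat.card (R ⧸ Ideal.span {x, y}) ^ (d + v) := by
  have hspan_x := card_quotient_span_singleton_pow_dvd hxy d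
  have hspan_xy := card_quotient_span_pair_pow_dvd x y v
  rw [hx, Ideal.span_singleton_zero, Nat.card_congr (RingEquiv.quotientBot R).toEquiv] at hspan_x
  rw [Ideal.span_insert, sup_eq_left.2 (Ideal.span_singleton_le_span_singleton.2 hy)] at hspan_xy
  rw [pow_add]
  exact hspan_x.trans (mul_dvd_mul_left _ hspan_xy)

open MvPolynomial in
theorem card_dvd_of_surjective_of_map_X_eq_zero {σ : Type*} {f : MvPolynomial σ ℤ →+* R}
    (hf : Function.Surjective f) (hX : ∀ i, f (X i) = 0) {n : ℕ} (hn : (n : R) = 0) :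
    Nat.card R ∣ n := by
  have hconst (p : MvPolynomial σ ℤ) : f p = ((constantCoeff p : ℤ) : R) :=
    RingHom.congr_fun (ringHom_ext (f := f) (g := (Int.castRingHom R).comp constantCoeff)
      (by simp) (by simpa using hX)) p
  let F : ZMod n →+ R := ZMod.lift n ⟨Int.castAddHom R, by simpa using hn⟩
  have hF : Function.Surjective F := fun r => by
    obtain ⟨p, rfl⟩ := hf r
    exact ⟨((constantCoeff p : ℤ) : ZMod n), by simp [F, hconst]⟩
  simpa using AddSubgroup.card_dvd_of_surjective F hF

end Counting

section Commutator

variable {G H : Type*} [Group G] [Group H]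

theorem map_rightComm (f : G →* H) (a b : G) : f (rightComm a b) = rightComm (f a) (f b) := by
  simp only [rightComm, map_mul, map_inv]

theorem rightComm_inv (a b : G) : (rightComm a b)⁻¹ = rightComm b a := by
  simp only [rightComm]
  group

theorem rightComm_eq_one_iff {a b : G} : rightComm a b = 1 ↔ a * b = b * a := by
  rw [rightComm, mul_assoc, ← mul_inv_rev, inv_mul_eq_one, eq_comm]

theorem commutator_le_of_closure_eq_top {s : Set G} (hs : Subgroup.closure s = ⊤)
    {N : Subgroup G} [N.Normal] (h : ∀ a ∈ s, ∀ b ∈ s, rightComm a b ∈ N) :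
    commutator G ≤ N := by
  rw [← Subgroup.Normal.quotient_commutative_iff_commutator_le]
  set q := QuotientGroup.mk' N
  have hcomm : ∀ a ∈ q '' s, ∀ b ∈ q '' s, a * b = b * a := by
    rintro _ ⟨a, ha, rfl⟩ _ ⟨b, hb, rfl⟩
    rw [← rightComm_eq_one_iff, ← map_rightComm]
    exact (QuotientGroup.eq_one_iff _).2 (h a ha b hb)
  have htop : Subgroup.closure (q '' s) = ⊤ := by
    rw [← MonoidHom.map_closure, hs,
      Subgroup.map_top_of_surjective _ (QuotientGroup.mk'_surjective N)]
  have hclosure := Subgroup.isMulCommutative_closure hcomm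
  rw [htop] at hclosure
  exact ⟨⟨fun a b => congrArg Subtype.val
    (mul_comm' (⟨a, trivial⟩ : (⊤ : Subgroup (G ⧸ N))) ⟨b, trivial⟩)⟩⟩

theorem normal_of_closure_eq_top {s : Set G} (hs : Subgroup.closure s = ⊤) {N : Subgroup G}
    [Finite N] (h : ∀ g ∈ s, ∀ t ∈ N, g⁻¹ * t * g ∈ N) : N.Normal := by
  rw [← Subgroup.normalizer_eq_top_iff, eq_top_iff, ← hs, Subgroup.closure_le]
  intro g hg
  have hfinite : Finite (N : Set G) := ‹Finite N›
  exact inv_mem_iff.1 (Subgroup.mem_normalizer_fintype fun t ht => by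
    rw [inv_inv]
    exact h g hg t ht)

theorem card_commutator_of_abelianization_equiv {p n : ℕ} [NeZero p]
    (f : Abelianization G ≃* Multiplicative (ZMod p × ZMod p)) (hG : Nat.card G = p ^ (n + 2)) :
    Nat.card (commutator G) = p ^ n := by
  have hab : Nat.card (G ⧸ commutator G) = p ^ 2 := by
    rw [sq, ← Nat.card_zmod p, ← Nat.card_prod]
    exact Nat.card_congr f.toEquiv
  have hmul := Subgroup.card_eq_card_quotient_mul_card_subgroup (commutator G)
  rw [hG, hab, pow_add, mul_comm] at hmul
  exact (Nat.eq_of_mul_eq_mul_left (pow_pos (NeZero.pos p) 2) hmul).symm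

end Commutator

section Annihilator

open scoped IsMulCommutative
open MvPolynomial

variable {G : Type*} [Group G] {x y : G}

theorem shiftedEval_one : shiftedEval x y 1 = 1 := by
  simpa [shiftedEval] using (basisMonomials (Fin 2) ℤ).constr_basis ℤ
    (fun d => (MonoidAlgebra.of ℤ G x - 1) ^ d 0 * (MonoidAlgebra.of ℤ G y - 1) ^ d 1) 0

theorem shiftedEval_X (i : Fin 2) :
    shiftedEval x y (X i) = MonoidAlgebra.of ℤ G (![x, y] i) - 1 := by
  have h := (basisMonomials (Fin 2) ℤ).constr_basis ℤ
    (fun d => (MonoidAlgebra.of ℤ G x - 1) ^ d 0 * (MonoidAlgebra.of ℤ G y - 1) ^ d 1)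
    (Finsupp.single i 1)
  fin_cases i <;> simpa [shiftedEval, X] using h

variable [IsMulCommutative (commutator G)]

theorem coe_symbolicPower_of_sub_one (g : G) (t : commutator G) :
    (symbolicPower t (MonoidAlgebra.of ℤ G g - 1) : G) = rightComm (t : G) g := by
  have haction : groupRingAction (MonoidAlgebra.of ℤ G g - 1) = conjAction g - 1 := by
    simp [groupRingAction]
  have hsub : (conjAction g - 1).unop (Additive.ofMul t) =
      -Additive.ofMul t + (conjAction g).unop (Additive.ofMul t) := by
    rw [neg_add_eq_sub]
    rfl
  rw [symbolicPower, haction, hsub]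
  change (t : G)⁻¹ * (((conjAction g).unop (Additive.ofMul t)).toMul : commutator G) = _
  rw [conjAction_apply, rightComm]
  group

/-- The map `Ψ : f ↦ s₂^{f(x-1, y-1)}` as a homomorphism of additive groups, whose kernel is the
annihilator. -/
noncomputable def furtwaenglerHom (x y : G) :
    MvPolynomial (Fin 2) ℤ →+ Additive (commutator G) where
  toFun f := Additive.ofMul (furtwaenglerMap x y f)
  map_zero' := by simp [furtwaenglerMap, symbolicPower]
  map_add' f g := by
    simp only [furtwaenglerMap, symbolicPower, map_add, MulOpposite.unop_add]
    rfl

theorem furtwaenglerMap_add (f g : MvPolynomial (Fin 2) ℤ) :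
    furtwaenglerMap x y (f + g) = furtwaenglerMap x y f * furtwaenglerMap x y g :=
  map_add (furtwaenglerHom x y) f g

theorem furtwaenglerMap_nsmul (n : ℕ) (f : MvPolynomial (Fin 2) ℤ) :
    furtwaenglerMap x y (n • f) = furtwaenglerMap x y f ^ n :=
  map_nsmul (furtwaenglerHom x y) n f

theorem sub_C_mul_mem_annihilatorIdeal {f g : MvPolynomial (Fin 2) ℤ} {a : ℤ} :
    f - C a * g ∈ annihilatorIdeal x y ↔ furtwaenglerMap x y f = furtwaenglerMap x y g ^ a := by
  rw [← smul_eq_C_mul]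
  change furtwaenglerHom x y (f - a • g) = 0 ↔ furtwaenglerHom x y f = a • furtwaenglerHom x y g
  rw [map_sub, map_zsmul, sub_eq_zero]

theorem furtwaenglerMap_one : furtwaenglerMap x y 1 = mainCommutator x y := by
  rw [furtwaenglerMap, shiftedEval_one, symbolicPower, map_one]
  rfl

theorem coe_furtwaenglerMap_mul_X (f : MvPolynomial (Fin 2) ℤ) (i : Fin 2) :
    (furtwaenglerMap x y (f * X i) : G) = rightComm (furtwaenglerMap x y f : G) (![x, y] i) := by
  have hmul : furtwaenglerMap x y (f * X i) =
      symbolicPower (furtwaenglerMap x y f) (shiftedEval x y (X i)) := by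
    simp only [furtwaenglerMap, symbolicPower, groupRingAction_shiftedEval_mul,
      MulOpposite.unop_mul]
    rfl
  rw [hmul, shiftedEval_X, coe_symbolicPower_of_sub_one]

theorem coe_furtwaenglerMap_X_pow (i : Fin 2) (n : ℕ) :
    (furtwaenglerMap x y (X i ^ n) : G) = iterComm (rightComm y x) (![x, y] i) n := by
  induction n with
  | zero => rw [pow_zero, furtwaenglerMap_one]; rfl
  | succ n ih => rw [pow_succ, coe_furtwaenglerMap_mul_X, ih]; rfl

theorem coe_furtwaenglerMap_X_zero_pow (n : ℕ) :
    (furtwaenglerMap x y (X 0 ^ n) : G) = sElt x y (n + 2) :=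
  coe_furtwaenglerMap_X_pow 0 n

theorem coe_furtwaenglerMap_X_one_pow (n : ℕ) :
    (furtwaenglerMap x y (X 1 ^ n) : G) = tElt x y (n + 2) :=
  coe_furtwaenglerMap_X_pow 1 n

theorem coe_furtwaenglerMap_X_zero_mul_X_one :
    (furtwaenglerMap x y (X 0 * X 1) : G) = rightComm (sElt x y 3) y := by
  rw [coe_furtwaenglerMap_mul_X, ← pow_one (X 0), coe_furtwaenglerMap_X_zero_pow]
  rfl

theorem coe_furtwaenglerMap_tracePoly :
    (furtwaenglerMap x y tracePoly : G) =
      sElt x y 2 ^ 3 * (sElt x y 3 * tElt x y 3) ^ 3 * sElt x y 4 * tElt x y 4 := by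
  have htrace : tracePoly = 3 • (X 0 ^ 0) + 3 • (X 0 ^ 1 + X 1 ^ 1) + X 0 ^ 2 + X 1 ^ 2 := by
    simp only [tracePoly, nsmul_eq_mul]
    push_cast
    ring
  simp only [htrace, furtwaenglerMap_add, furtwaenglerMap_nsmul, Subgroup.coe_mul,
    Subgroup.coe_pow, coe_furtwaenglerMap_X_zero_pow, coe_furtwaenglerMap_X_one_pow]

theorem furtwaenglerHom_surjective [Finite (commutator G)]
    (hxy : Subgroup.closure {x, y} = ⊤) : Function.Surjective (furtwaenglerHom x y) := by
  set N := (furtwaenglerHom x y).toMultiplicativeLeft.range.map (commutator G).subtype with hN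
  have mem_N {t : G} : t ∈ N ↔ ∃ f, (furtwaenglerMap x y f : G) = t := by
    simp only [hN, Subgroup.mem_map, MonoidHom.mem_range, exists_exists_eq_and]
    rfl
  have hgen (g : G) (hg : g ∈ ({x, y} : Set G)) : ∃ i, g = ![x, y] i := by
    simpa [Fin.exists_fin_two] using hg
  have hnormal : N.Normal := by
    have hfinite : Finite N := Finite.Set.subset (commutator G : Set G) (Subgroup.map_subtype_le _)
    refine normal_of_closure_eq_top hxy fun g hg t ht => ?_
    obtain ⟨i, rfl⟩ := hgen g hg
    obtain ⟨f, rfl⟩ := mem_N.1 ht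
    have hcomm := N.mul_mem ht (mem_N.2 ⟨f * X i, coe_furtwaenglerMap_mul_X f i⟩)
    simpa only [rightComm, mul_assoc, mul_inv_cancel_left] using hcomm
  have hmain : rightComm y x ∈ N := mem_N.2 ⟨1, congrArg Subtype.val furtwaenglerMap_one⟩
  have hle : commutator G ≤ N := by
    refine commutator_le_of_closure_eq_top hxy ?_
    rintro a (rfl | rfl) b (rfl | rfl)
    · rw [rightComm_eq_one_iff.2 rfl]; exact N.one_mem
    · rw [← rightComm_inv]; exact N.inv_mem hmain
    · exact hmain
    · rw [rightComm_eq_one_iff.2 rfl]; exact N.one_mem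
  intro t
  obtain ⟨f, hf⟩ := mem_N.1 (hle t.toMul.2)
  exact ⟨f, congrArg Additive.ofMul (Subtype.ext hf)⟩

theorem annihilatorIdeal_eq_of_le [Finite (commutator G)] (hxy : Subgroup.closure {x, y} = ⊤)
    {B : Ideal (MvPolynomial (Fin 2) ℤ)} (hB : B ≤ annihilatorIdeal x y)
    (hcard : Nat.card (MvPolynomial (Fin 2) ℤ ⧸ B) ∣ Nat.card (commutator G)) :
    annihilatorIdeal x y = B := by
  have hindex : (annihilatorIdeal x y).toAddSubgroup.index = Nat.card (commutator G) := by
    change (furtwaenglerHom x y).ker.index = _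
    rw [AddSubgroup.index_ker, AddMonoidHom.range_eq_top.2 (furtwaenglerHom_surjective hxy),
      AddSubgroup.card_top]
    rfl
  have hrel := AddSubgroup.relIndex_mul_index (Submodule.toAddSubgroup_mono hB)
  change _ = Nat.card (MvPolynomial (Fin 2) ℤ ⧸ B) at hrel
  rw [← hrel, hindex] at hcard
  have hone := Nat.dvd_of_mul_dvd_mul_right Nat.card_pos (hcard.trans (one_mul _).symm.dvd)
  exact le_antisymm (fun f hf => AddSubgroup.relIndex_eq_one.1 (Nat.dvd_one.1 hone) hf) hB

end Annihilator

section NebelungIdeal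

open MvPolynomial

/-- The ideal `(X^{m-2}, Y^{e-1} - a X^{m-3}, XY - b X^{m-3}, T + c X^{m-3})`, the common shape of
the annihilators of all representatives, meant for `m ≥ 3` and `e ≥ 1`; here `X = X 0`, `Y = X 1`.
-/
noncomputable def nebelungIdeal (m e : ℕ) (a b c : ℤ) : Ideal (MvPolynomial (Fin 2) ℤ) :=
  Ideal.span {X 0 ^ (m - 2), X 1 ^ (e - 1) - C a * X 0 ^ (m - 3),
    X 0 * X 1 - C b * X 0 ^ (m - 3), tracePoly + C c * X 0 ^ (m - 3)}

variable {m e : ℕ} {a b c : ℤ}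

theorem card_quotient_nebelungIdeal_dvd (hm : 4 ≤ m) (hb : b = 0 ∨ 5 ≤ m) :
    Nat.card (MvPolynomial (Fin 2) ℤ ⧸ nebelungIdeal m e a b c) ∣ 3 ^ (m - 3 + (e - 1)) := by
  obtain ⟨d, rfl⟩ := Nat.exists_eq_add_of_le' hm
  set π := Ideal.Quotient.mk (nebelungIdeal (d + 4) e a b c) with hπ
  have hx : π (X 0) ^ (d + 1 + 1) = 0 := by
    rw [← map_pow, Ideal.Quotient.eq_zero_iff_mem]
    exact Ideal.subset_span (by simp)
  have hy : π (X 1) ^ (e - 1) = π (C a) * π (X 0) ^ (d + 1) := by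
    rw [← map_pow, ← map_pow, ← map_mul, Ideal.Quotient.eq]
    exact Ideal.subset_span (by simp)
  have hxy : π (X 0) * π (X 1) = π (C b) * π (X 0) ^ (d + 1) := by
    rw [← map_pow, ← map_mul, ← map_mul, Ideal.Quotient.eq]
    exact Ideal.subset_span (by simp)
  have htrace : π tracePoly + π (C c) * π (X 0) ^ (d + 1) = 0 := by
    rw [← map_pow, ← map_mul, ← map_add, Ideal.Quotient.eq_zero_iff_mem]
    exact Ideal.subset_span (by simp)
  have hdvd : Nat.card (_ ⧸ Ideal.span {π (X 0), π (X 1)}) ∣ 3 := by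
    refine card_dvd_of_surjective_of_map_X_eq_zero
      (f := (Ideal.Quotient.mk (Ideal.span {π (X 0), π (X 1)})).comp π)
      (Ideal.Quotient.mk_surjective.comp Ideal.Quotient.mk_surjective) ?_ ?_
    · intro i
      refine Ideal.Quotient.eq_zero_iff_mem.2 (Ideal.subset_span ?_)
      fin_cases i <;> simp
    · rw [← map_natCast (Ideal.Quotient.mk _), Ideal.Quotient.eq_zero_iff_mem]
      refine Ideal.mem_span_pair.2
        ⟨-(π (X 0) + 3 + π (C c) * π (X 0) ^ d), -(3 + π (X 1)), ?_⟩
      simp only [tracePoly, map_add, map_mul, map_pow, map_ofNat] at htrace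
      push_cast
      linear_combination -htrace
  refine (card_dvd_card_quotient_span_pair_pow hx ?_ ?_).trans (pow_dvd_pow_of_dvd hdvd _)
  · exact hy ▸ Dvd.dvd.mul_left (dvd_pow_self _ d.succ_ne_zero) _
  · rw [hxy]
    obtain rfl | hd := hb
    · simp
    · exact Dvd.dvd.mul_left (pow_dvd_pow _ (by omega)) _

variable {G : Type*} [Group G] [IsMulCommutative (commutator G)] {x y : G}

theorem nebelungIdeal_le_annihilatorIdeal (hm : 3 ≤ m) (he : 1 ≤ e) (hs : sElt x y m = 1)
    (ht : tElt x y (e + 1) = sElt x y (m - 1) ^ a)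
    (hst : rightComm (sElt x y 3) y = sElt x y (m - 1) ^ b)
    (htrace : sElt x y 2 ^ 3 * (sElt x y 3 * tElt x y 3) ^ 3 * sElt x y 4 * tElt x y 4 =
      sElt x y (m - 1) ^ (-c)) :
    nebelungIdeal m e a b c ≤ annihilatorIdeal x y := by
  obtain ⟨d, rfl⟩ := Nat.exists_eq_add_of_le' hm
  obtain ⟨v, rfl⟩ := Nat.exists_eq_add_of_le' he
  rw [nebelungIdeal, Ideal.span_le]
  rintro f (rfl | rfl | rfl | rfl)
  · exact Subtype.ext ((coe_furtwaenglerMap_X_zero_pow _).trans hs)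
  · refine sub_C_mul_mem_annihilatorIdeal.2 (Subtype.ext ?_)
    rw [Subgroup.coe_zpow, coe_furtwaenglerMap_X_one_pow, coe_furtwaenglerMap_X_zero_pow]
    exact ht
  · refine sub_C_mul_mem_annihilatorIdeal.2 (Subtype.ext ?_)
    rw [Subgroup.coe_zpow, coe_furtwaenglerMap_X_zero_mul_X_one, coe_furtwaenglerMap_X_zero_pow]
    exact hst
  · rw [← neg_neg c, C_neg, neg_mul, ← sub_eq_add_neg]
    refine sub_C_mul_mem_annihilatorIdeal.2 (Subtype.ext ?_)
    rw [Subgroup.coe_zpow, coe_furtwaenglerMap_tracePoly, coe_furtwaenglerMap_X_zero_pow]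
    exact htrace

theorem annihilatorIdeal_eq_nebelungIdeal (hxy : Subgroup.closure {x, y} = ⊤) (hm : 4 ≤ m)
    (he : 1 ≤ e) (hcard : Nat.card (commutator G) = 3 ^ (m + e - 4)) (hb : b = 0 ∨ 5 ≤ m)
    (hs : sElt x y m = 1) (ht : tElt x y (e + 1) = sElt x y (m - 1) ^ a)
    (hst : rightComm (sElt x y 3) y = sElt x y (m - 1) ^ b)
    (htrace : sElt x y 2 ^ 3 * (sElt x y 3 * tElt x y 3) ^ 3 * sElt x y 4 * tElt x y 4 =
      sElt x y (m - 1) ^ (-c)) :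
    annihilatorIdeal x y = nebelungIdeal m e a b c := by
  have : Finite (commutator G) := Nat.finite_of_card_ne_zero (by simp [hcard])
  refine annihilatorIdeal_eq_of_le hxy
    (nebelungIdeal_le_annihilatorIdeal (by omega) he hs ht hst htrace) ?_
  rw [hcard, show m + e - 4 = m - 3 + (e - 1) by omega]
  exact card_quotient_nebelungIdeal_dvd hm hb

end NebelungIdeal

section Nebelung

variable {G H : Type*} [Group G] [Group H]

theorem map_iterComm (f : G →* H) (a b : G) (i : ℕ) :
    f (iterComm a b i) = iterComm (f a) (f b) i := by
  induction i with
  | zero => rfl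
  | succ i ih => rw [iterComm, map_rightComm, ih, iterComm]

theorem map_sElt (f : G →* H) (x y : G) (j : ℕ) : f (sElt x y j) = sElt (f x) (f y) j := by
  rw [sElt, map_iterComm, map_rightComm, sElt]

theorem map_tElt (f : G →* H) (x y : G) (j : ℕ) : f (tElt x y j) = tElt (f x) (f y) j := by
  rw [tElt, map_iterComm, map_rightComm, tElt]

theorem map_sigmaElt (f : G →* H) (x y : G) (j : ℕ) :
    f (sigmaElt x y j) = sigmaElt (f x) (f y) j := by
  rw [sigmaElt, map_iterComm, map_pow, sigmaElt]

theorem map_tauElt (f : G →* H) (x y : G) (j : ℕ) : f (tauElt x y j) = tauElt (f x) (f y) j := by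
  rw [tauElt, map_iterComm, map_pow, tauElt]

/-- The elements `x`, `y` satisfy the defining relations of Nebelung's representative; they need not
generate the group and may satisfy further relations. -/
def SatisfiesNebelungRel (m e k : ℕ) (ρ α β γ δ : ℤ) (x y : G) : Prop :=
  ∀ a b, NebelungRel m e k ρ α β γ δ x y a b → a = b

variable {m n e k : ℕ} {ρ α β γ δ : ℤ} {x y : G}

theorem NebelungRel.exists_map_eq {f : G →* H} (hf : Function.Surjective f) {c d : H}
    (h : NebelungRel m e k ρ α β γ δ (f x) (f y) c d) :
    ∃ a b, NebelungRel m e k ρ α β γ δ x y a b ∧ f a = c ∧ f b = d := by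
  cases h with
  | metabelian c d hc hd =>
    rw [commutator_def, ← Subgroup.map_top_of_surjective f hf, ← Subgroup.map_commutator] at hc hd
    obtain ⟨a, ha, rfl⟩ := hc
    obtain ⟨b, hb, rfl⟩ := hd
    exact ⟨_, _, .metabelian a b ha hb, map_mul f a b, map_mul f b a⟩
  | _ =>
    simp only [← map_sElt, ← map_tElt, ← map_sigmaElt, ← map_tauElt, ← map_rightComm, ← map_mul,
      ← map_pow, ← map_zpow, ← map_inv, ← map_one f]
    refine ⟨_, _, ?_, rfl, rfl⟩
    constructor <;> assumption

theorem satisfiesNebelungRel_map {f : NebelungGroup m n k ρ α β γ δ →* G}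
    (hf : Function.Surjective f) :
    SatisfiesNebelungRel m (n - m + 2) k ρ α β γ δ (f (NebelungGroup.gen m n k ρ α β γ δ 0))
      (f (NebelungGroup.gen m n k ρ α β γ δ 1)) := by
  set π := f.comp (PresentedGroup.mk (nebelungRelators m n k ρ α β γ δ))
  have hπ : Function.Surjective π := hf.comp (PresentedGroup.mk_surjective _)
  intro c d hcd
  obtain ⟨a, b, hab, rfl, rfl⟩ := NebelungRel.exists_map_eq (f := π) hπ hcd
  have hone : PresentedGroup.mk (nebelungRelators m n k ρ α β γ δ) (a * b⁻¹) = 1 :=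
    PresentedGroup.one_of_mem ⟨a, b, hab, rfl⟩
  rw [map_mul, map_inv, mul_inv_eq_one] at hone
  exact congrArg f hone

theorem closure_map_gen {f : NebelungGroup m n k ρ α β γ δ →* G} (hf : Function.Surjective f) :
    Subgroup.closure {f (NebelungGroup.gen m n k ρ α β γ δ 0),
      f (NebelungGroup.gen m n k ρ α β γ δ 1)} = ⊤ := by
  have hrange : ({f (NebelungGroup.gen m n k ρ α β γ δ 0),
      f (NebelungGroup.gen m n k ρ α β γ δ 1)} : Set G) = f '' Set.range PresentedGroup.of := by
    rw [← Set.range_comp]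
    ext g
    simp [Fin.exists_fin_two, NebelungGroup.gen, eq_comm]
  rw [hrange, ← MonoidHom.map_closure, PresentedGroup.closure_range_of,
    Subgroup.map_top_of_surjective f hf]

namespace SatisfiesNebelungRel

theorem sElt_eq_one (h : SatisfiesNebelungRel m e k ρ α β γ δ x y) (hm : 5 ≤ m) :
    sElt x y m = 1 := by
  rw [h _ _ (.conn_s m hm), h _ _ (.nilp_sigma m le_rfl), h _ _ (.nilp_sigma (m + 1) m.le_succ),
    inv_one, one_mul]

theorem sElt_pred (h : SatisfiesNebelungRel m e k ρ α β γ δ x y) (hm : 6 ≤ m) :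
    sElt x y (m - 1) = (sigmaElt x y (m - 1))⁻¹ := by
  rw [h _ _ (.conn_s (m - 1) (by omega)), h _ _ (.nilp_sigma (m - 1 + 1) (by omega)), inv_one,
    mul_one]

theorem sElt_four (h : SatisfiesNebelungRel 4 e k ρ α β γ δ x y) :
    sElt x y 4 = sigmaElt x y 3 ^ (ρ * β) := by
  have hs := h _ _ .second_s4
  rwa [h _ _ (.nilp_sigma 4 le_rfl), h _ _ (.nilp_sigma 5 (by omega)), mul_one, mul_one] at hs

theorem tElt_succ (h : SatisfiesNebelungRel m e k ρ α β γ δ x y) (hk : k ≤ 1) (he : 4 ≤ e) :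
    tElt x y (e + 1) = sigmaElt x y (m - 1) ^ (-ρ) := by
  rw [h _ _ (.conn_t (e + 1) (by omega)), h _ _ .central_tau,
    h _ _ (.nilp_tau (e + 1 + 1) (by omega)), mul_one]

theorem tElt_four (h : SatisfiesNebelungRel m 3 k ρ α β γ δ x y) (hk : k ≤ 1) :
    tElt x y 4 = sigmaElt x y (m - 1) ^ (-((1 - β) * ρ)) := by
  have ht := h _ _ .second_t4
  rw [h _ _ (.nilp_tau 5 (by omega)), inv_one, mul_one, mul_inv_eq_iff_eq_mul,
    h _ _ .central_tau, ← zpow_add] at ht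
  rw [ht]
  congr 1
  ring

theorem sigmaElt_zpow_eq_one (h : SatisfiesNebelungRel m e 0 ρ α β γ δ x y) :
    sigmaElt x y (m - 1) ^ ρ = 1 := by
  rw [← inv_eq_one, ← zpow_neg, ← h _ _ .central_tau, h _ _ (.nilp_tau (e + 1) le_rfl)]

variable [IsMulCommutative (commutator G)]

theorem annihilatorIdeal_eq_of_defect_zero (h : SatisfiesNebelungRel m e 0 ρ α β γ δ x y)
    (hxy : Subgroup.closure {x, y} = ⊤) (hm : 4 ≤ m) (he : 3 ≤ e)
    (hcard : Nat.card (commutator G) = 3 ^ (m + e - 4)) :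
    annihilatorIdeal x y = nebelungIdeal m e 0 0 0 := by
  have hσ (c : ℤ) : sigmaElt x y (m - 1) ^ (ρ * c) = 1 := by
    rw [zpow_mul, h.sigmaElt_zpow_eq_one, one_zpow]
  refine annihilatorIdeal_eq_nebelungIdeal hxy hm (by omega) hcard (.inl rfl) ?_ ?_ ?_ ?_
  · obtain rfl | hm := hm.eq_or_lt
    · rw [h.sElt_four, hσ]
    · exact h.sElt_eq_one hm
  · rw [zpow_zero]
    obtain rfl | he := he.eq_or_lt
    · rw [h.tElt_four zero_le_one, mul_comm, ← mul_neg, hσ]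
    · rw [h.tElt_succ zero_le_one he, ← mul_neg_one, hσ]
  · rw [h _ _ .central_s3_y, ← mul_neg, hσ, zpow_zero]
  · rw [h _ _ .central_trace, hσ, neg_zero, zpow_zero]

theorem annihilatorIdeal_eq_of_tElt_eq (h : SatisfiesNebelungRel m e k ρ α β γ δ x y)
    (hxy : Subgroup.closure {x, y} = ⊤) (hm : 6 ≤ m) (he : 1 ≤ e)
    (hcard : Nat.card (commutator G) = 3 ^ (m + e - 4)) {a : ℤ}
    (ha : tElt x y (e + 1) = sigmaElt x y (m - 1) ^ (-a)) :
    annihilatorIdeal x y = nebelungIdeal m e a (ρ * δ) (ρ * β) := by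
  have hs (c : ℤ) : sElt x y (m - 1) ^ c = sigmaElt x y (m - 1) ^ (-c) := by
    rw [h.sElt_pred hm, inv_zpow']
  refine annihilatorIdeal_eq_nebelungIdeal hxy (by omega) he hcard (.inr (by omega))
    (h.sElt_eq_one (by omega)) ?_ ?_ ?_
  · rw [ha, hs]
  · rw [h _ _ .central_s3_y, hs]
  · rw [h _ _ .central_trace, hs, neg_neg]

end SatisfiesNebelungRel

end Nebelung

open MvPolynomial in
theorem mainTheorem1_general {G : Type*} [Group G] [IsMulCommutative (commutator G)]
    {m e k : ℕ} {ρ α β γ δ : ℤ} {x y : G}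
    (hxy : Subgroup.closure {x, y} = ⊤) (h : SatisfiesNebelungRel m e k ρ α β γ δ x y)
    (hm : 4 ≤ m) (he : 3 ≤ e) (hcard : Nat.card (commutator G) = 3 ^ (m + e - 4)) :
    (k = 0 →
      annihilatorIdeal x y =
        Ideal.span {X 0 ^ (m - 2), X 1 ^ (e - 1), X 0 * X 1, tracePoly}) ∧
    (k = 1 → 6 ≤ m → 4 ≤ e →
      annihilatorIdeal x y =
        Ideal.span {X 0 ^ (m - 2),
          X 1 ^ (e - 1) - C ρ * X 0 ^ (m - 3),
          X 0 * X 1 - C (ρ * δ) * X 0 ^ (m - 3),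
          tracePoly + C (ρ * β) * X 0 ^ (m - 3)}) ∧
    (k = 1 → 6 ≤ m → e = 3 →
      annihilatorIdeal x y =
        Ideal.span {X 0 ^ (m - 2),
          X 1 ^ 2 - C ((1 - β) * ρ) * X 0 ^ (m - 3),
          X 0 * X 1 - C (ρ * δ) * X 0 ^ (m - 3),
          tracePoly + C (ρ * β) * X 0 ^ (m - 3)}) := by
  refine ⟨?_, ?_, ?_⟩
  · rintro rfl
    simpa [nebelungIdeal] using h.annihilatorIdeal_eq_of_defect_zero hxy hm he hcard
  · rintro rfl hm6 he4
    exact h.annihilatorIdeal_eq_of_tElt_eq hxy hm6 (by omega) hcard (h.tElt_succ le_rfl he4)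
  · rintro rfl hm6 rfl
    exact h.annihilatorIdeal_eq_of_tElt_eq hxy hm6 (by omega) hcard (h.tElt_four le_rfl)

open MvPolynomial in
theorem mainTheorem1 {G : Type*} [Group G] [Finite G]
    -- `G` is metabelian, with `G/G'` of type `(3,3)`
    [IsMulCommutative (commutator G)]
    (hab : Nonempty (Abelianization G ≃* Multiplicative (ZMod 3 × ZMod 3)))
    -- order, index of nilpotency, CF-invariant and defect of commutativity
    (m n e k : ℕ)
    (hcard : Nat.card G = 3 ^ n) (hn5 : 5 ≤ n)
    (hm : nilpotencyIndex G = m) (hm4 : 4 ≤ m)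
    (hmn : m + 1 ≤ n) (hnm : n ≤ 2 * m - 3)
    (hcf : cfInvariant G = e) (he : e = n - m + 2)
    (hk : HasDefect G k)
    -- `G` is isomorphic to the representative `G_ρ^{m,n}(α,β,γ,δ)`
    (ρ α β γ δ : ℤ)
    (hρ : ρ ∈ Set.Icc (-1) 1) (hα : α ∈ Set.Icc (-1) 1) (hβ : β ∈ Set.Icc (-1) 1)
    (hγ : γ ∈ Set.Icc (-1) 1) (hδ : δ ∈ Set.Icc (-1) 1)
    (φ : NebelungGroup m n k ρ α β γ δ ≃* G)
    -- the generators `x`, `y` of `G` that correspond to those of the representative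
    (x y : G)
    (hx : x = φ (NebelungGroup.gen m n k ρ α β γ δ 0))
    (hy : y = φ (NebelungGroup.gen m n k ρ α β γ δ 1)) :
    (k = 0 →
      annihilatorIdeal x y =
        Ideal.span {X 0 ^ (m - 2), X 1 ^ (e - 1), X 0 * X 1, tracePoly}) ∧
    (k = 1 → 6 ≤ m → 4 ≤ e →
      annihilatorIdeal x y =
        Ideal.span {X 0 ^ (m - 2),
          X 1 ^ (e - 1) - C ρ * X 0 ^ (m - 3),
          X 0 * X 1 - C (ρ * δ) * X 0 ^ (m - 3),
          tracePoly + C (ρ * β) * X 0 ^ (m - 3)}) ∧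
    (k = 1 → 6 ≤ m → e = 3 →
      annihilatorIdeal x y =
        Ideal.span {X 0 ^ (m - 2),
          X 1 ^ 2 - C ((1 - β) * ρ) * X 0 ^ (m - 3),
          X 0 * X 1 - C (ρ * δ) * X 0 ^ (m - 3),
          tracePoly + C (ρ * β) * X 0 ^ (m - 3)}) := by
  obtain ⟨f⟩ := hab
  subst hx hy he
  exact mainTheorem1_general (closure_map_gen (f := φ.toMonoidHom) φ.surjective)
    (satisfiesNebelungRel_map (f := φ.toMonoidHom) φ.surjective) hm4 (by omega)
    (card_commutator_of_abelianization_equiv f (hcard.trans (by congr 1; omega)))
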